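/- \textbf{Setting.} Let $(\mathcal C,\mathcal M)$ be an $\mathcal M$-adhesive category ($\mathcal M$ is a class of monomorphisms containing all isomorphisms and closed under composition and decomposition; pushouts and pullbacks along $\mathcal M$-morphisms exist and preserve $\mathcal M$; pushouts along $\mathcal M$-morphisms are van Kampen for cubes whose vertical morphisms are in $\mathcal M$) with binary coproducts and a unique $\mathcal E'$-$\mathcal M$ pair factorization (each pair $A\to X\leftarrow B$ factors, uniquely up to isomorphism, as a pair $A\to K\leftarrow B$ in $\mathcal E'$ followed by some $K\to X$ in $\mathcal M$). \textbf{Conditions and rules.} Application conditions (ACs) over an object $P$ are built inductively from $\exists(a,c)$, with $a\colon P\to Q$ and $c$ an AC over $Q$, negation, and conjunctions over index sets. A morphism $p\colon P\to G$ satisfies $\exists(a,c)$ if some $q\in\mathcal M$ has $q\circ a=p$ and $q\models c$; negation and conjunction are as usual. For $b\colon P\to P'$, $\mathrm{Shift}(b,\cdot)$ commutes with $\neg,\bigwedge$, and $\mathrm{Shift}(b,\exists(a,c))=\bigvee\exists(a',\mathrm{Shift}(b',c))$ over all $(a',b')\in\mathcal E'$ with $b'\in\mathcal M$ and $a'\circ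 b=b'\circ a$; it satisfies $n\circ b\models c\iff n\models\mathrm{Shift}(b,c)$. For a span $\rho=(L\leftarrow I\to R)$ in $\mathcal M$, $\mathrm{Left}(\rho,\cdot)$ takes ACs over $R$ to ACs over $L$ and commutes with $\neg,\bigwedge$; $\mathrm{Left}(\rho,\exists(a,c))=\exists(b,\mathrm{Left}(\rho^*,c))$, where $\rho^*=(X\leftarrow Y\to Q)$ and $b\colon L\to X$ arise from a pushout complement $I\to Y\to Q$ of $I\to R\xrightarrow{a}Q$ and the pushout $X$ of $L\leftarrow I\to Y$, and it is $\mathrm{false}$ if there is no such complement. A plain rule is a span $p=(L\leftarrow I\to R)$ in $\mathcal M$; a rule $\rho=\langle p,ac_L\rangle$ adds an AC over $L$. A plain (AC-disregarding) transformation $G\Rightarrow_{p,m}H$ is a double pushout $(L\leftarrow I\to R)\to(G\xleftarrow{k}D\xrightarrow{c}H)$ with match $m\colon L\to G$; a transformation via $\rho$ also requires $m\models ac_L$. A transformation pair $H_1\Leftarrow_{\rho_1,m_1}G\Rightarrow_{\rho_2,m_2}H_2$ is parallel independent if there are $d_{12}\colon L_1\to D_2$ with $k_2d_{12}=m_1$,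 $c_2d_{12}\models ac_{L_1}$ and $d_{21}\colon L_2\to D_1$ with $k_1d_{21}=m_2$, $c_1d_{21}\models ac_{L_2}$; otherwise it is parallel dependent, i.e. a conflict. For plain pairs the AC requirements are dropped. \textbf{Initial pairs.} A pair on $K$ embeds into a pair on $G$ via $f\colon K\to G$ if there are extension diagrams over $f$: for both transformations, the lower double pushout is the vertical composite of the upper one with a double pushout whose left vertical morphism is $f$. A plain pair $tp^I$ is initial for a plain pair $tp$ if it embeds into $tp$ via some $f^I$ such that for every plain pair $tp'$ embedding into $tp$ via some $f$, there are unique extension diagrams embedding $tp^I$ into $tp'$ via a morphism $f'$ with $f\circ f'=f^I$. A plain initial conflict is a plain conflict isomorphic to an initial pair for itself. Let $tp_{L_1+L_2}\colon R_1+L_2\Leftarrow L_1+L_2\Rightarrow L_1+R_2$ be the plain pair whose matches are the coproduct injections. \textbf{Symbolic pairs.} A symbolic transformation pair for $\langle\rho_1,\rho_2\rangle$ is a triple $\langle tp_K,ac_K,ac^*_K\rangle$, where $tp_K$ is a pair of AC-disregarding transformations of $K$ with matches $o_1,o_2$ and derived spans $p_i^*=(K\xleftarrow{k_i}D_i\xrightarrow{c_i}P_i)$,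 $ac_K=\mathrm{Shift}(o_1,ac_{L_1})\wedge\mathrm{Shift}(o_2,ac_{L_2})$ and $ac^*_K=\neg(ac^*_{K,d_{12}}\wedge ac^*_{K,d_{21}})$; here $ac^*_{K,d_{12}}=\mathrm{Left}(p_2^*,\mathrm{Shift}(c_2d_{12},ac_{L_1}))$ if there is $d_{12}$ with $k_2d_{12}=o_1$, and $\mathrm{false}$ otherwise; $ac^*_{K,d_{21}}$ is defined symmetrically. Symbolic pairs are isomorphic if their AC-disregarding pairs are. A symbolic pair is conflict-inducing if $tp_K$ embeds into some conflict for $\langle\rho_1,\rho_2\rangle$. It is an initial conflict if it is conflict-inducing and $tp_K$ is a plain initial conflict or isomorphic to $tp_{L_1+L_2}$ and parallel independent as a plain pair. A set $\mathcal S$ of symbolic pairs is complete w.r.t. parallel dependence if for each conflict for $\langle\rho_1,\rho_2\rangle$, on an object $G$, some $\langle tp_K,ac_K,ac_K^*\rangle\in\mathcal S$ embeds into it via some $m\colon K\to G$ with $m\models ac_K\wedge ac^*_K$. \textbf{Corollary (minimally complete).} Let $\mathcal R$ be a set of rules such that for all $\rho_1,\rho_2\in\mathcal R$, with underlying plain rules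 $p_1,p_2$, each plain conflict for $\langle p_1,p_2\rangle$ has an initial transformation pair. Let $\rho_1,\rho_2\in\mathcal R$ and let $\mathcal S$ be the set of initial conflicts for $\langle\rho_1,\rho_2\rangle$ up to isomorphism, i.e. a set of initial conflicts containing exactly one representative of each isomorphism class. Then $\mathcal S$ is minimally complete w.r.t. parallel dependence: $\mathcal S$ is complete, and there is no complete set $\mathcal S'$ of symbolic transformation pairs for $\langle\rho_1,\rho_2\rangle$ of strictly smaller cardinality than $\mathcal S$. -/

import Mathlib

open CategoryTheory CategoryTheory.Limits

universe u v

namespace MTransf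

/-! ### `M`-adhesive categories and `E'`-`M` pair factorizations -/

section Categories

variable {C : Type u} [Category.{v} C]

/-- The (vertical) `M`-van Kampen property of a pushout square: in every commutative cube over it
whose back faces are pullbacks and whose vertical morphisms lie in `M`, the top face is a pushout
if and only if the front faces are pullbacks. -/
def IsMVanKampen (M : MorphismProperty C) {W X Y Z : C}
    (f : W ⟶ X) (g : W ⟶ Y) (h : X ⟶ Z) (i : Y ⟶ Z) : Prop :=
  ∀ ⦃W' X' Y' Z' : C⦄ (f' : W' ⟶ X') (g' : W' ⟶ Y') (h' : X' ⟶ Z') (i' : Y' ⟶ Z')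
    (αW : W' ⟶ W) (αX : X' ⟶ X) (αY : Y' ⟶ Y) (αZ : Z' ⟶ Z),
    M αW → M αX → M αY → M αZ →
    IsPullback f' αW αX f → IsPullback g' αW αY g →
    CommSq h' αX αZ h → CommSq i' αY αZ i → CommSq f' g' h' i' →
    (IsPushout f' g' h' i' ↔ IsPullback h' αX αZ h ∧ IsPullback i' αY αZ i)

/-- `(C, M)` is an `M`-adhesive category. -/
structure IsMAdhesive (M : MorphismProperty C) : Prop where
  mono : ∀ ⦃X Y : C⦄ (f : X ⟶ Y), M f → Mono f
  of_isIso : ∀ ⦃X Y : C⦄ (f : X ⟶ Y), IsIso f → M f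
  comp : ∀ ⦃X Y Z : C⦄ (f : X ⟶ Y) (g : Y ⟶ Z), M f → M g → M (f ≫ g)
  decomp : ∀ ⦃X Y Z : C⦄ (f : X ⟶ Y) (g : Y ⟶ Z), M (f ≫ g) → M g → M f
  hasPushout : ∀ ⦃W X Y : C⦄ (f : W ⟶ X) (g : W ⟶ Y), M f → HasPushout f g
  hasPullback : ∀ ⦃X Y Z : C⦄ (f : X ⟶ Z) (g : Y ⟶ Z), M f → HasPullback f g
  cobaseChange : ∀ ⦃W X Y Z : C⦄ (f : W ⟶ X) (g : W ⟶ Y) (h : X ⟶ Z) (i : Y ⟶ Z),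
    IsPushout f g h i → M f → M i
  baseChange : ∀ ⦃W X Y Z : C⦄ (f : W ⟶ X) (g : W ⟶ Y) (h : X ⟶ Z) (i : Y ⟶ Z),
    IsPullback f g h i → M i → M f
  vanKampen : ∀ ⦃W X Y Z : C⦄ (f : W ⟶ X) (g : W ⟶ Y) (h : X ⟶ Z) (i : Y ⟶ Z),
    M f → IsPushout f g h i → IsMVanKampen M f g h i

/-- A class of pairs of morphisms with the same codomain. -/
abbrev PairClass (C : Type u) [Category.{v} C] : Type (max u v) :=
  ∀ ⦃A B X : C⦄, (A ⟶ X) → (B ⟶ X) → Prop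

/-- `C` has a unique `E'`-`M` pair factorization: every pair of morphisms with the same codomain
factors as a pair in `E'` followed by a morphism in `M`, and the factorization is unique up to
isomorphism. -/
structure HasUniquePairFactorization (E' : PairClass C) (M : MorphismProperty C) : Prop where
  exists_fac : ∀ ⦃A B X : C⦄ (f : A ⟶ X) (g : B ⟶ X),
    ∃ (K : C) (e₁ : A ⟶ K) (e₂ : B ⟶ K) (m : K ⟶ X),
      E' e₁ e₂ ∧ M m ∧ e₁ ≫ m = f ∧ e₂ ≫ m = g
  unique_fac : ∀ ⦃A B X K K' : C⦄ (e₁ : A ⟶ K) (e₂ : B ⟶ K) (m : K ⟶ X)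
    (e₁' : A ⟶ K') (e₂' : B ⟶ K') (m' : K' ⟶ X),
    E' e₁ e₂ → M m → E' e₁' e₂' → M m' → e₁ ≫ m = e₁' ≫ m' → e₂ ≫ m = e₂' ≫ m' →
    ∃ φ : K ≅ K', e₁ ≫ φ.hom = e₁' ∧ e₂ ≫ φ.hom = e₂' ∧ φ.hom ≫ m' = m

end Categories

/-! ### Nested application conditions -/

/-- Nested application conditions over an object. Conjunctions range over arbitrary (in
particular, all finite) index sets, so that shifting along a morphism is always defined. -/
inductive AC {C : Type u} [Category.{v} C] : C → Type (max (u + 1) (v + 1))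
  | ex {P Q : C} (a : P ⟶ Q) (c : AC Q) : AC P
  | neg {P : C} (c : AC P) : AC P
  | conj {P : C} (ι : Type (max u v)) (c : ι → AC P) : AC P

namespace AC

variable {C : Type u} [Category.{v} C]

/-- The condition `true`: the empty conjunction. -/
def tt (P : C) : AC P := conj PEmpty (fun i => nomatch i)

/-- The condition `false`. -/
def ff (P : C) : AC P := neg (tt P)

/-- Binary conjunction. -/
def and {P : C} (c d : AC P) : AC P := conj (ULift Bool) (fun i => if i.down then c else d)

/-- Disjunction over an index set. -/
def disj {P : C} (ι : Type (max u v)) (c : ι → AC P) : AC P := neg (conj ι (fun i => neg (c i)))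

/-- Satisfaction `p ⊨ c` of an application condition `c` over `P` by a morphism `p : P ⟶ G`. -/
def Sat (M : MorphismProperty C) : {P : C} → AC P → {G : C} → (P ⟶ G) → Prop
  | _, @ex _ _ _ Q a c, G, p => ∃ q : Q ⟶ G, M q ∧ a ≫ q = p ∧ c.Sat M q
  | _, neg c, _, p => ¬ c.Sat M p
  | _, conj _ c, _, p => ∀ i, (c i).Sat M p

/-- The index set of the disjunction in the shift of `∃ (a, c)` along `b`: the pairs
`(a', b') ∈ E'` with `b' ∈ M` that complete `a` and `b` to a commutative square. -/
structure ShiftIndex (E' : PairClass C) (M : MorphismProperty C) {P P' Q : C}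
    (a : P ⟶ Q) (b : P ⟶ P') : Type (max u v) where
  obj : C
  a' : P' ⟶ obj
  b' : Q ⟶ obj
  mem : E' a' b'
  hb' : M b'
  comm : b ≫ a' = a ≫ b'

/-- `Shift (b, c)`: the shift of an application condition `c` over `P` along `b : P ⟶ P'`. -/
def shift (E' : PairClass C) (M : MorphismProperty C) :
    {P : C} → AC P → {P' : C} → (P ⟶ P') → AC P'
  | _, ex a c, _, b => disj (ShiftIndex E' M a b) (fun s => ex s.a' (c.shift E' M s.b'))
  | _, neg c, _, b => neg (c.shift E' M b)
  | _, conj ι c, _, b => conj ι (fun i => (c i).shift E' M b)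

/-- The data of the double pushout

```
L <-l- I -r-> R
|b     |y     |a
X <-x- Y -z-> Q
```
over a span `L ⟵ I ⟶ R` and a morphism `a : R ⟶ Q`. -/
structure LeftData {L I R Q : C} (l : I ⟶ L) (r : I ⟶ R) (a : R ⟶ Q) where
  Y : C
  X : C
  y : I ⟶ Y
  z : Y ⟶ Q
  b : L ⟶ X
  x : Y ⟶ X
  right : IsPushout r y a z
  left : IsPushout l y b x

open Classical in
/-- `Left (ρ, c)`: the shift of an application condition `c` over the right-hand side `R` over
the rule `ρ = (L ⟵ I ⟶ R)`, from right to left. The condition `∃ (a, c)` becomes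
`∃ (b, Left (ρ*, c))` if `a` and `r` have a pushout complement, with `ρ* = (X ⟵ Y ⟶ Q)` and
`b : L ⟶ X` given by the resulting double pushout, and becomes `false` otherwise. -/
noncomputable def left : {R : C} → AC R → {L I : C} → (I ⟶ L) → (I ⟶ R) → AC L
  | _, ex a c, L, _, l, r =>
      if h : Nonempty (LeftData l r a) then ex h.some.b (c.left h.some.x h.some.z) else ff L
  | _, neg c, _, _, l, r => neg (c.left l r)
  | _, conj ι c, _, _, l, r => conj ι (fun i => (c i).left l r)

end AC

/-! ### Rules, direct transformations and transformation pairs -/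

section Transformations

variable {C : Type u} [Category.{v} C]

/-- A plain rule `L ⟵ I ⟶ R` with both morphisms in `M`. -/
structure PlainRule (M : MorphismProperty C) where
  L : C
  I : C
  R : C
  l : I ⟶ L
  r : I ⟶ R
  hl : M l
  hr : M r

/-- A rule: a plain rule with an application condition over its left-hand side. -/
structure Rule (M : MorphismProperty C) extends PlainRule M where
  ac : AC L

variable {M : MorphismProperty C}

/-- A plain (or: AC-disregarding) direct transformation `G ⟹ H` via `p`:

```
L <-l- I -r-> R
|m     |i     |n
G <-k- D -c-> H
```
with both squares pushouts. -/
structure DPO (p : PlainRule M) (G : C) where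
  D : C
  H : C
  m : p.L ⟶ G
  i : p.I ⟶ D
  n : p.R ⟶ H
  k : D ⟶ G
  c : D ⟶ H
  left : IsPushout p.l i m k
  right : IsPushout p.r i n c

/-- A pair `H₁ ⟸ G ⟹ H₂` of plain (or: AC-disregarding) transformations. -/
structure PlainPair (p₁ p₂ : PlainRule M) where
  G : C
  t₁ : DPO p₁ G
  t₂ : DPO p₂ G

/-- A transformation pair for rules with application conditions: both matches satisfy the
application condition of their rule. -/
structure TransfPair (ρ₁ ρ₂ : Rule M) extends PlainPair ρ₁.toPlainRule ρ₂.toPlainRule where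
  sat₁ : ρ₁.ac.Sat M t₁.m
  sat₂ : ρ₂.ac.Sat M t₂.m

/-- Parallel independence of a pair of plain transformations. -/
def PlainPair.ParallelIndependent {p₁ p₂ : PlainRule M} (tp : PlainPair p₁ p₂) : Prop :=
  (∃ d₁₂ : p₁.L ⟶ tp.t₂.D, d₁₂ ≫ tp.t₂.k = tp.t₁.m) ∧
  (∃ d₂₁ : p₂.L ⟶ tp.t₁.D, d₂₁ ≫ tp.t₁.k = tp.t₂.m)

/-- A pair of plain transformations is in conflict if it is not parallel independent. -/
def PlainPair.Conflicting {p₁ p₂ : PlainRule M} (tp : PlainPair p₁ p₂) : Prop :=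
  ¬ tp.ParallelIndependent

/-- Parallel independence of a transformation pair for rules with application conditions. -/
def TransfPair.ParallelIndependent {ρ₁ ρ₂ : Rule M} (tp : TransfPair ρ₁ ρ₂) : Prop :=
  (∃ d₁₂ : ρ₁.L ⟶ tp.t₂.D, d₁₂ ≫ tp.t₂.k = tp.t₁.m ∧ ρ₁.ac.Sat M (d₁₂ ≫ tp.t₂.c)) ∧
  (∃ d₂₁ : ρ₂.L ⟶ tp.t₁.D, d₂₁ ≫ tp.t₁.k = tp.t₂.m ∧ ρ₂.ac.Sat M (d₂₁ ≫ tp.t₁.c))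

/-- A transformation pair is in conflict (parallel dependent) if it is not parallel
independent. -/
def TransfPair.Conflicting {ρ₁ ρ₂ : Rule M} (tp : TransfPair ρ₁ ρ₂) : Prop :=
  ¬ tp.ParallelIndependent

/-- An extension diagram over `f : G ⟶ G'`: the double pushout of `t'` is the vertical composite
of the double pushout of `t` with a double pushout `(D ⟶ D', G ⟶ G', H ⟶ H')`. -/
structure ExtensionDiagram {p : PlainRule M} {G G' : C} (t : DPO p G) (t' : DPO p G')
    (f : G ⟶ G') where
  d : t.D ⟶ t'.D
  h : t.H ⟶ t'.H
  match_comp : t.m ≫ f = t'.m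
  interface_comp : t.i ≫ d = t'.i
  comatch_comp : t.n ≫ h = t'.n
  left : IsPushout t.k d f t'.k
  right : IsPushout t.c d h t'.c

/-- An embedding of a transformation pair into another one: extension diagrams for both
transformations via a common extension morphism. -/
structure Embedding {p₁ p₂ : PlainRule M} (tp tp' : PlainPair p₁ p₂) where
  f : tp.G ⟶ tp'.G
  e₁ : ExtensionDiagram tp.t₁ tp'.t₁ f
  e₂ : ExtensionDiagram tp.t₂ tp'.t₂ f

/-- Two pairs of plain transformations are isomorphic. -/
def PlainPair.Isomorphic {p₁ p₂ : PlainRule M} (tp tp' : PlainPair p₁ p₂) : Prop :=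
  ∃ e : Embedding tp tp', IsIso e.f ∧ IsIso e.e₁.d ∧ IsIso e.e₁.h ∧ IsIso e.e₂.d ∧ IsIso e.e₂.h

/-! ### Initial transformation pairs for plain rules -/

/-- `tpI` is an initial transformation pair for `tp`. -/
def IsInitialTransfPair {p₁ p₂ : PlainRule M} (tpI tp : PlainPair p₁ p₂) : Prop :=
  ∃ eI : Embedding tpI tp, ∀ (tp' : PlainPair p₁ p₂) (e : Embedding tp' tp),
    ∃! e' : Embedding tpI tp', e'.f ≫ e.f = eI.f

/-- The system with set of rules `R` has initial transformation pairs for conflicts along plain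
rules. -/
def HasInitialTransfPairsForConflicts (R : Set (Rule M)) : Prop :=
  ∀ ρ₁ ∈ R, ∀ ρ₂ ∈ R, ∀ tp : PlainPair ρ₁.toPlainRule ρ₂.toPlainRule, tp.Conflicting →
    ∃ tpI : PlainPair ρ₁.toPlainRule ρ₂.toPlainRule, IsInitialTransfPair tpI tp

/-- Initial conflicts for plain rules: conflicts that are isomorphic to their initial
transformation pair. -/
def PlainPair.IsPlainInitialConflict {p₁ p₂ : PlainRule M} (tp : PlainPair p₁ p₂) : Prop :=
  tp.Conflicting ∧ ∃ tpI : PlainPair p₁ p₂, IsInitialTransfPair tpI tp ∧ tp.Isomorphic tpI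

theorem isPushout_coprod_inr [HasBinaryCoproducts C] {A B : C} (f : A ⟶ B) (X : C) :
    IsPushout f (coprod.inr : A ⟶ X ⨿ A) (coprod.inr : B ⟶ X ⨿ B) (coprod.map (𝟙 X) f) :=
  (IsPushout.of_coprod_inl_with_id f X).flip.of_iso (Iso.refl A) (Iso.refl B)
    (coprod.braiding A X) (coprod.braiding B X) (by simp)
    (by simpa using coprod.inl_desc _ _) (by simpa using coprod.inl_desc _ _)
    (by ext <;> simp)

/-- The transformation pair `R₁ + L₂ ⟸ L₁ + L₂ ⟹ L₁ + R₂` whose matches are the coproduct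
injections. -/
noncomputable def coprodPair [HasBinaryCoproducts C] (p₁ p₂ : PlainRule M) : PlainPair p₁ p₂ where
  G := p₁.L ⨿ p₂.L
  t₁ :=
    { D := p₁.I ⨿ p₂.L
      H := p₁.R ⨿ p₂.L
      m := coprod.inl
      i := coprod.inl
      n := coprod.inl
      k := coprod.map p₁.l (𝟙 p₂.L)
      c := coprod.map p₁.r (𝟙 p₂.L)
      left := (IsPushout.of_coprod_inl_with_id p₁.l p₂.L).flip
      right := (IsPushout.of_coprod_inl_with_id p₁.r p₂.L).flip }
  t₂ :=
    { D := p₁.L ⨿ p₂.I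
      H := p₁.L ⨿ p₂.R
      m := coprod.inr
      i := coprod.inr
      n := coprod.inr
      k := coprod.map (𝟙 p₁.L) p₂.l
      c := coprod.map (𝟙 p₁.L) p₂.r
      left := isPushout_coprod_inr p₂.l p₁.L
      right := isPushout_coprod_inr p₂.r p₁.L }

/-- Initial parallel independent transformation pairs for plain rules. -/
def PlainPair.IsInitialParallelIndependent [HasBinaryCoproducts C] {p₁ p₂ : PlainRule M}
    (tp : PlainPair p₁ p₂) : Prop :=
  tp.ParallelIndependent ∧ tp.Isomorphic (coprodPair p₁ p₂)

/-! ### Symbolic transformation pairs -/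

/-- The extension AC of a pair of AC-disregarding transformations. -/
def extensionAC (E' : PairClass C) {ρ₁ ρ₂ : Rule M}
    (tp : PlainPair ρ₁.toPlainRule ρ₂.toPlainRule) : AC tp.G :=
  AC.and (ρ₁.ac.shift E' M tp.t₁.m) (ρ₂.ac.shift E' M tp.t₂.m)

open Classical in
/-- The condition `ac*_{K, d₁₂}`. -/
noncomputable def independenceAC₁₂ (E' : PairClass C) {ρ₁ ρ₂ : Rule M}
    (tp : PlainPair ρ₁.toPlainRule ρ₂.toPlainRule) : AC tp.G :=
  if h : ∃ d₁₂ : ρ₁.L ⟶ tp.t₂.D, d₁₂ ≫ tp.t₂.k = tp.t₁.m then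
    (ρ₁.ac.shift E' M (h.choose ≫ tp.t₂.c)).left tp.t₂.k tp.t₂.c
  else AC.ff tp.G

open Classical in
/-- The condition `ac*_{K, d₂₁}`. -/
noncomputable def independenceAC₂₁ (E' : PairClass C) {ρ₁ ρ₂ : Rule M}
    (tp : PlainPair ρ₁.toPlainRule ρ₂.toPlainRule) : AC tp.G :=
  if h : ∃ d₂₁ : ρ₂.L ⟶ tp.t₁.D, d₂₁ ≫ tp.t₁.k = tp.t₂.m then
    (ρ₂.ac.shift E' M (h.choose ≫ tp.t₁.c)).left tp.t₁.k tp.t₁.c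
  else AC.ff tp.G

/-- The conflict-inducing AC of a pair of AC-disregarding transformations. -/
noncomputable def conflictInducingAC (E' : PairClass C) {ρ₁ ρ₂ : Rule M}
    (tp : PlainPair ρ₁.toPlainRule ρ₂.toPlainRule) : AC tp.G :=
  AC.neg (AC.and (independenceAC₁₂ E' tp) (independenceAC₂₁ E' tp))

/-- A symbolic transformation pair `⟨tp_K, ac_K, ac*_K⟩` for `⟨ρ₁, ρ₂⟩`. -/
structure SymbolicPair (E' : PairClass C) (ρ₁ ρ₂ : Rule M) where
  tp : PlainPair ρ₁.toPlainRule ρ₂.toPlainRule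
  extAC : AC tp.G
  conflictAC : AC tp.G
  extAC_eq : extAC = extensionAC E' tp
  conflictAC_eq : conflictAC = conflictInducingAC E' tp

variable {E' : PairClass C} {ρ₁ ρ₂ : Rule M}

/-- Symbolic transformation pairs are isomorphic if their underlying pairs of AC-disregarding
transformations are; these determine the two application conditions. -/
def SymbolicPair.Isomorphic (s s' : SymbolicPair E' ρ₁ ρ₂) : Prop :=
  s.tp.Isomorphic s'.tp

/-- The unfolding of a symbolic transformation pair: all transformation pairs into which the
underlying AC-disregarding pair can be embedded. -/
def SymbolicPair.unfolding (s : SymbolicPair E' ρ₁ ρ₂) : Set (TransfPair ρ₁ ρ₂) :=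
  {tp | Nonempty (Embedding s.tp tp.toPlainPair)}

/-- A symbolic transformation pair is conflict-inducing if its unfolding contains a conflict. -/
def SymbolicPair.ConflictInducing (s : SymbolicPair E' ρ₁ ρ₂) : Prop :=
  ∃ tp ∈ s.unfolding, tp.Conflicting

/-- Initial conflicts for rules with application conditions. -/
def SymbolicPair.IsInitialConflict [HasBinaryCoproducts C] (s : SymbolicPair E' ρ₁ ρ₂) : Prop :=
  s.ConflictInducing ∧ (s.tp.IsPlainInitialConflict ∨ s.tp.IsInitialParallelIndependent)

/-- Completeness of a set of symbolic transformation pairs w.r.t. parallel dependence. -/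
def IsComplete (S : Set (SymbolicPair E' ρ₁ ρ₂)) : Prop :=
  ∀ tp : TransfPair ρ₁ ρ₂, tp.Conflicting →
    ∃ s ∈ S, ∃ e : Embedding s.tp tp.toPlainPair, (AC.and s.extAC s.conflictAC).Sat M e.f

/-- `S` is the set of initial conflicts up to isomorphism: it consists of initial conflicts, and
every initial conflict is isomorphic to exactly one element of `S`. -/
def IsSetOfInitialConflictsUpToIso [HasBinaryCoproducts C]
    (S : Set (SymbolicPair E' ρ₁ ρ₂)) : Prop :=
  (∀ s ∈ S, s.IsInitialConflict) ∧
  ∀ s : SymbolicPair E' ρ₁ ρ₂, s.IsInitialConflict → ∃! s', s' ∈ S ∧ s.Isomorphic s'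

/-- A set of symbolic transformation pairs is minimally complete w.r.t. parallel dependence if it
is complete and no set of symbolic transformation pairs of smaller cardinality is complete. -/
def IsMinimallyComplete (S : Set (SymbolicPair E' ρ₁ ρ₂)) : Prop :=
  IsComplete S ∧
  ¬ ∃ S' : Set (SymbolicPair E' ρ₁ ρ₂), IsComplete S' ∧ Cardinal.mk S' < Cardinal.mk S

end Transformations

end MTransf

namespace MTransf

/-! ### Pushouts along `M`-morphisms -/

section Categories

variable {C : Type u} [Category.{v} C] {M : MorphismProperty C}

/-! Completeness rests on two facts. First, an embedding of a symbolic pair into a conflict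
satisfies its two conditions automatically: satisfaction of `shift` and `left` translates, along the
extension diagrams, into satisfaction by the matches and by the comatch-side morphisms
(`AC.sat_shift`, `AC.sat_left`). So `ac_K` holds because the matches satisfy their conditions, and a
failure of `ac*_K` would make the conflict independent. Second, some initial conflict embeds into
every conflict. If the underlying plain pair is dependent, its initial pair does. If it is
independent, so that only the conditions cause the conflict, the coproduct pair does.

For minimality, each initial conflict `s` embeds into some conflict, and a complete `S'` has an
element `s'` embedding into that same conflict. The assignment `s ↦ s'` is injective because `s'`
determines `s` up to isomorphism. Embeddings preserve and reflect plain parallel independence. If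
`s'` is independent, `s` is the coproduct pair. Otherwise `s` is the initial pair of the conflict,
hence embeds into `s'`, and is therefore the initial pair of `s'`, which does not depend on the
conflict.

The categorical input is the van Kampen property, through pushout-pullback decomposition and
uniqueness of pushout complements. -/

theorem IsMAdhesive.id_mem (hM : IsMAdhesive M) (X : C) : M (𝟙 X) :=
  hM.of_isIso _ inferInstance

/-- Supplies the faces with an identity edge in the van Kampen cubes below. -/
theorem isPullback_of_comp_mono {A B E : C} (k : A ⟶ B) (r : B ⟶ E) [Mono r] :
    IsPullback k (𝟙 A) r (k ≫ r) :=
  ⟨⟨by simp⟩, ⟨PullbackCone.IsLimit.mk _ (fun s => s.snd)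
    (fun s => by rw [← cancel_mono r, Category.assoc]; exact s.condition.symm)
    (fun s => by simp) (fun s m _ h => by simpa using h)⟩⟩

/-- Pushouts along `M`-morphisms are pullbacks. -/
theorem IsMAdhesive.isPullback_of_isPushout (hM : IsMAdhesive M) {W X Y Z : C}
    {f : W ⟶ X} {g : W ⟶ Y} {h : X ⟶ Z} {i : Y ⟶ Z} (hf : M f) (po : IsPushout f g h i) :
    IsPullback g f i h := by
  have := hM.mono f hf
  -- The cube has top face `W, W, Y, Y`, a pushout because two opposite sides are identities; the
  -- front face over `h` is the pullback sought.
  have key := (hM.vanKampen f g h i hf po (𝟙 W) g g (𝟙 Y) (𝟙 W) f (𝟙 Y) i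
    (hM.id_mem _) hf (hM.id_mem _) (hM.cobaseChange f g h i po hf)
    (by simpa using isPullback_of_comp_mono (𝟙 W) f)
    (IsPullback.of_vert_isIso ⟨by simp⟩) ⟨po.w.symm⟩ ⟨by simp⟩ ⟨by simp⟩).1
    (IsPushout.of_horiz_isIso ⟨by simp⟩)
  exact key.1

/-- The `M`-pushout-pullback decomposition: in a diagram
```
A -k-> B -r-> E
|l     |s     |v
X -a-> D -w-> F
```
whose outer rectangle is a pushout and whose right square is a pullback, with `l` and `w` in `M`,
both squares are pushouts. -/
theorem IsMAdhesive.pushout_pullback_decomposition (hM : IsMAdhesive M) {A B E X D F : C}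
    {k : A ⟶ B} {r : B ⟶ E} {l : A ⟶ X} {s : B ⟶ D} {v : E ⟶ F} {a : X ⟶ D} {w : D ⟶ F}
    (hl : M l) (hw : M w) (outer : IsPushout l (k ≫ r) (a ≫ w) v) (pb : IsPullback s r w v)
    (comm : l ≫ a = k ≫ s) : IsPushout l k a s ∧ IsPushout s r w v := by
  have hr : M r := hM.baseChange _ _ _ _ pb.flip hw
  have := hM.mono w hw
  have := hM.mono r hr
  -- The cube stands over the outer pushout, with vertical morphisms `𝟙 A`, `𝟙 X`, `r` and `w`.
  have top : IsPushout l k a s :=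
    (hM.vanKampen l (k ≫ r) (a ≫ w) v hl outer l k a s (𝟙 A) (𝟙 X) r w
      (hM.id_mem _) (hM.id_mem _) hr hw (IsPullback.of_vert_isIso ⟨by simp⟩)
      (isPullback_of_comp_mono k r) ⟨by simp⟩ ⟨pb.w⟩ ⟨comm⟩).2
      ⟨isPullback_of_comp_mono a w, pb⟩
  exact ⟨top, (IsPushout.of_left outer.flip pb.w.symm top.flip).flip⟩

/-- A pushout complement of `l ∈ M` and `b` factors through every other one. -/
theorem IsMAdhesive.exists_hom_of_pushoutComplements (hM : IsMAdhesive M) {A L X Y Y' : C}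
    {l : A ⟶ L} {b : L ⟶ X} {y : A ⟶ Y} {x : Y ⟶ X} {y' : A ⟶ Y'} {x' : Y' ⟶ X}
    (hl : M l) (po : IsPushout l y b x) (po' : IsPushout l y' b x') :
    ∃ φ : Y' ⟶ Y, φ ≫ x = x' ∧ y' ≫ φ = y := by
  have hx : M x := hM.cobaseChange _ _ _ _ po hl
  have hx' : M x' := hM.cobaseChange _ _ _ _ po' hl
  have := hM.mono x hx
  have := hM.mono l hl
  have := hM.hasPullback x x' hx
  have pb : IsPullback (pullback.snd x x') (pullback.fst x x') x' x :=
    (IsPullback.of_hasPullback x x').flip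
  let t : A ⟶ pullback x x' := pullback.lift y y' (by rw [← po.w, ← po'.w])
  have ht₁ : t ≫ pullback.fst x x' = y := pullback.lift_fst _ _ _
  have ht₂ : t ≫ pullback.snd x x' = y' := pullback.lift_snd _ _ _
  have hy : IsPullback t (𝟙 A) (pullback.fst x x') y := by
    have := hM.mono _ (hM.baseChange _ _ _ _ pb.flip hx')
    simpa [ht₁] using isPullback_of_comp_mono t (pullback.fst x x')
  -- Pulling the first pushout back along `x'` turns `l` into `𝟙 A`, so the projection from the
  -- pullback to `Y'` is a pushout of an identity.
  have top : IsPushout (𝟙 A) t y' (pullback.snd x x') :=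
    (hM.vanKampen l y b x hl po (𝟙 A) t y' (pullback.snd x x') (𝟙 A) l (pullback.fst x x') x'
      (hM.id_mem _) hl (hM.baseChange _ _ _ _ pb.flip hx') hx'
      (by simpa using isPullback_of_comp_mono (𝟙 A) l) hy ⟨po'.w.symm⟩ ⟨pb.w⟩
      ⟨by simp [ht₂]⟩).2 ⟨hM.isPullback_of_isPushout hl po', pb⟩
  have : IsIso (pullback.snd x x') := top.isIso_inr_of_isIso
  refine ⟨inv (pullback.snd x x') ≫ pullback.fst x x', ?_, ?_⟩
  · rw [Category.assoc, IsIso.inv_comp_eq, pb.w]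
  · rw [← ht₂, Category.assoc, IsIso.hom_inv_id_assoc, ht₁]

/-- Pushout complements of `l ∈ M` and `b` are unique up to isomorphism. -/
theorem IsMAdhesive.exists_iso_of_pushoutComplements (hM : IsMAdhesive M) {A L X Y Y' : C}
    {l : A ⟶ L} {b : L ⟶ X} {y : A ⟶ Y} {x : Y ⟶ X} {y' : A ⟶ Y'} {x' : Y' ⟶ X}
    (hl : M l) (po : IsPushout l y b x) (po' : IsPushout l y' b x') :
    ∃ φ : Y ≅ Y', φ.hom ≫ x' = x ∧ y ≫ φ.hom = y' := by
  obtain ⟨φ, h₁, h₂⟩ := hM.exists_hom_of_pushoutComplements hl po' po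
  obtain ⟨ψ, h₃, -⟩ := hM.exists_hom_of_pushoutComplements hl po po'
  have := hM.mono x (hM.cobaseChange _ _ _ _ po hl)
  have := hM.mono x' (hM.cobaseChange _ _ _ _ po' hl)
  exact ⟨⟨φ, ψ, by simp [← cancel_mono x, h₁, h₃], by simp [← cancel_mono x', h₁, h₃]⟩, h₁, h₂⟩

/-- If a pushout along `l ∈ M` has its lower side `L ⟶ G` factored as `b ≫ q` with `q ∈ M` and
`Y` is a pushout complement of `l` and `b`, then the pushout splits into two pushouts over `Y`. -/
theorem IsMAdhesive.exists_split_of_pushoutComplement (hM : IsMAdhesive M) {I L Y X D G : C}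
    {l : I ⟶ L} {y : I ⟶ Y} {b : L ⟶ X} {x : Y ⟶ X} {q : X ⟶ G} {i : I ⟶ D} {k : D ⟶ G}
    (hl : M l) (hq : M q) (po : IsPushout l y b x) (outer : IsPushout l i (b ≫ q) k) :
    ∃ d : Y ⟶ D, y ≫ d = i ∧ M d ∧ IsPushout x d q k := by
  -- The pullback of `k` and `q` is itself a pushout complement of `l` and `b`, hence isomorphic to
  -- `Y`.
  have := hM.hasPullback k q (hM.cobaseChange _ _ _ _ outer hl)
  have pb := (IsPullback.of_hasPullback k q).flip
  let t : I ⟶ pullback k q := pullback.lift i (l ≫ b) (by simp [outer.w])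
  have ht₁ : t ≫ pullback.fst k q = i := pullback.lift_fst _ _ _
  have ht₂ : t ≫ pullback.snd k q = l ≫ b := pullback.lift_snd _ _ _
  obtain ⟨po₁, po₂⟩ := hM.pushout_pullback_decomposition (k := t) (r := pullback.fst k q) hl hq
    (by rwa [ht₁]) pb ht₂.symm
  obtain ⟨φ, h₁, h₂⟩ := hM.exists_iso_of_pushoutComplements hl po po₁
  refine ⟨φ.hom ≫ pullback.fst k q, by rw [← Category.assoc, h₂, ht₁], ?_, ?_⟩
  · exact hM.comp _ _ (hM.of_isIso _ inferInstance) (hM.baseChange _ _ _ _ pb.flip hq)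
  · exact po₂.of_iso φ.symm (Iso.refl _) (Iso.refl _) (Iso.refl _) (by simp [← h₁]) (by simp)
      (by simp) (by simp)

/-- The splitting of `exists_split_of_pushoutComplement` without a given complement. -/
theorem IsMAdhesive.exists_pushoutComplement (hM : IsMAdhesive M) {I L X D G : C}
    {l : I ⟶ L} {b : L ⟶ X} {q : X ⟶ G} {i : I ⟶ D} {k : D ⟶ G}
    (hl : M l) (hq : M q) (outer : IsPushout l i (b ≫ q) k) :
    ∃ (Y : C) (y : I ⟶ Y) (x : Y ⟶ X), IsPushout l y b x := by
  have := hM.hasPullback k q (hM.cobaseChange _ _ _ _ outer hl)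
  have pb := (IsPullback.of_hasPullback k q).flip
  exact ⟨_, pullback.lift i (l ≫ b) (by simp [outer.w]), _,
    (hM.pushout_pullback_decomposition (r := pullback.fst k q) hl hq
      (by rwa [pullback.lift_fst]) pb (pullback.lift_snd _ _ _).symm).1⟩

/-- A pushout of `l` and `i = y ≫ d` splits over the pushout of `l` and `y`. -/
theorem exists_split_of_isPushout {I L Y X D G : C} {l : I ⟶ L} {y : I ⟶ Y} {b : L ⟶ X}
    {x : Y ⟶ X} {i : I ⟶ D} {m : L ⟶ G} {k : D ⟶ G} {d : Y ⟶ D} (hd : y ≫ d = i)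
    (po : IsPushout l y b x) (outer : IsPushout l i m k) :
    ∃ q : X ⟶ G, b ≫ q = m ∧ IsPushout x d q k := by
  subst hd
  have w : l ≫ m = y ≫ d ≫ k := by rw [outer.w, Category.assoc]
  refine ⟨po.desc m (d ≫ k) w, po.inl_desc _ _ _, ?_⟩
  exact (IsPushout.of_left (by rw [po.inl_desc]; exact outer.flip) (po.inr_desc _ _ _).symm
    po.flip).flip

end Categories

/-! ### Satisfaction of shifted conditions -/

namespace AC

variable {C : Type u} [Category.{v} C] {M : MorphismProperty C}

theorem sat_ex {P Q G : C} (a : P ⟶ Q) (c : AC Q) (p : P ⟶ G) :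
    (ex a c).Sat M p ↔ ∃ q : Q ⟶ G, M q ∧ a ≫ q = p ∧ c.Sat M q := Iff.rfl

theorem sat_neg {P G : C} (c : AC P) (p : P ⟶ G) : (neg c).Sat M p ↔ ¬ c.Sat M p := Iff.rfl

theorem sat_conj {P G : C} (ι : Type (max u v)) (c : ι → AC P) (p : P ⟶ G) :
    (conj ι c).Sat M p ↔ ∀ i, (c i).Sat M p := Iff.rfl

theorem not_sat_ff {P G : C} (p : P ⟶ G) : ¬ (ff P).Sat M p :=
  fun h => h fun i => nomatch i

theorem sat_and {P G : C} (c d : AC P) (p : P ⟶ G) :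
    (c.and d).Sat M p ↔ c.Sat M p ∧ d.Sat M p :=
  ⟨fun h => ⟨h ⟨true⟩, h ⟨false⟩⟩, fun h i => by
    rcases i with ⟨_ | _⟩
    exacts [h.2, h.1]⟩

theorem sat_disj {P G : C} (ι : Type (max u v)) (c : ι → AC P) (p : P ⟶ G) :
    (disj ι c).Sat M p ↔ ∃ i, (c i).Sat M p := by
  simp [disj, sat_neg, sat_conj]

/-- In the existential case, a witness `q` for `b ≫ n` is paired with `n`, and the `E'`-part of the
factorization of `(n, q)` is the required index of the disjunction. -/
theorem sat_shift (hM : IsMAdhesive M) {E' : PairClass C}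
    (hE' : HasUniquePairFactorization E' M) {P : C} (c : AC P) {P' G : C} (b : P ⟶ P')
    (n : P' ⟶ G) : (c.shift E' M b).Sat M n ↔ c.Sat M (b ≫ n) := by
  induction c generalizing P' G with
  | @ex P Q a c ih =>
    change (disj _ fun s : ShiftIndex E' M a b => ex s.a' (c.shift E' M s.b')).Sat M n ↔ _
    rw [sat_disj]
    constructor
    · rintro ⟨s, q, hq, hqn, hc⟩
      exact ⟨s.b' ≫ q, hM.comp _ _ s.hb' hq, by rw [← Category.assoc, ← s.comm, Category.assoc, hqn],
        (ih s.b' q).1 hc⟩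
    · rintro ⟨q, hq, hqn, hc⟩
      obtain ⟨K, e₁, e₂, m, he, hm, rfl, rfl⟩ := hE'.exists_fac n q
      have := hM.mono m hm
      -- The second leg lies in `M` by decomposition, since its composite with `m` is the witness in
      -- `M`.
      refine ⟨⟨K, e₁, e₂, he, hM.decomp _ _ hq hm, by simp [← cancel_mono m, hqn]⟩, ?_⟩
      exact (sat_ex _ _ _).2 ⟨m, hm, rfl, (ih e₂ m).2 hc⟩
  | neg c ih => exact not_congr (ih b n)
  | conj ι c ih => exact forall_congr' fun i => ih i b n

/-- A witness in `M` on one side splits the double pushout into the one chosen for `a` and a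
remaining double pushout. The latter carries the witness to the other side and is where the
induction hypothesis applies. -/
theorem sat_left (hM : IsMAdhesive M) {R : C} (c : AC R) {L I G D H : C} {l : I ⟶ L} {r : I ⟶ R}
    (hl : M l) (hr : M r) {m : L ⟶ G} {i : I ⟶ D} {k : D ⟶ G} {n : R ⟶ H} {z : D ⟶ H}
    (pl : IsPushout l i m k) (pr : IsPushout r i n z) :
    (c.left l r).Sat M m ↔ c.Sat M n := by
  induction c generalizing L I G D H with
  | @ex P Q a c ih =>
    by_cases h : Nonempty (LeftData l r a)
    · have hex : (ex a c).left l r = ex h.some.b (c.left h.some.x h.some.z) := dif_pos h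
      rw [hex]
      -- The choice of complement is immaterial: the splitting works over any of them.
      generalize h.some = δ
      have hx : M δ.x := hM.cobaseChange _ _ _ _ δ.left hl
      have hz : M δ.z := hM.cobaseChange _ _ _ _ δ.right hr
      constructor
      · rintro ⟨q, hq, rfl, hc⟩
        obtain ⟨d, hd, hdM, po⟩ := hM.exists_split_of_pushoutComplement hl hq δ.left pl
        obtain ⟨q', hq', po'⟩ := exists_split_of_isPushout hd δ.right pr
        exact ⟨q', hM.cobaseChange _ _ _ _ po'.flip hdM, hq', (ih hx hz po po').1 hc⟩
      · rintro ⟨q, hq, rfl, hc⟩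
        obtain ⟨d, hd, hdM, po⟩ := hM.exists_split_of_pushoutComplement hr hq δ.right pr
        obtain ⟨q', hq', po'⟩ := exists_split_of_isPushout hd δ.left pl
        exact ⟨q', hM.cobaseChange _ _ _ _ po'.flip hdM, hq', (ih hx hz po' po).2 hc⟩
    · have hex : (ex a c).left l r = ff L := dif_neg h
      rw [hex]
      refine iff_of_false (not_sat_ff m) ?_
      rintro ⟨q, hq, rfl, -⟩
      -- A witness would produce a pushout complement, and a pushout along `l` completes it to the
      -- excluded double pushout.
      obtain ⟨Y, y, x, po⟩ := hM.exists_pushoutComplement hr hq pr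
      have := hM.hasPushout l y hl
      exact h ⟨⟨Y, _, y, x, _, _, po, IsPushout.of_hasPushout l y⟩⟩
  | neg c ih => exact not_congr (ih hl hr pl pr)
  | conj ι c ih => exact forall_congr' fun j => ih j hl hr pl pr

end AC

/-! ### Embeddings of transformation pairs -/

section Embeddings

variable {C : Type u} [Category.{v} C] {M : MorphismProperty C}

theorem DPO.k_mem (hM : IsMAdhesive M) {p : PlainRule M} {G : C} (t : DPO p G) : M t.k :=
  hM.cobaseChange _ _ _ _ t.left p.hl

theorem DPO.c_mem (hM : IsMAdhesive M) {p : PlainRule M} {G : C} (t : DPO p G) : M t.c :=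
  hM.cobaseChange _ _ _ _ t.right p.hr

/-- The identity extension diagram. -/
def ExtensionDiagram.refl {p : PlainRule M} {G : C} (t : DPO p G) :
    ExtensionDiagram t t (𝟙 G) where
  d := 𝟙 _
  h := 𝟙 _
  match_comp := Category.comp_id _
  interface_comp := Category.comp_id _
  comatch_comp := Category.comp_id _
  left := IsPushout.of_vert_isIso ⟨by simp⟩
  right := IsPushout.of_vert_isIso ⟨by simp⟩

/-- The composition of extension diagrams. -/
def ExtensionDiagram.trans {p : PlainRule M} {G G' G'' : C} {t : DPO p G} {t' : DPO p G'}
    {t'' : DPO p G''} {f : G ⟶ G'} {f' : G' ⟶ G''} (e : ExtensionDiagram t t' f)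
    (e' : ExtensionDiagram t' t'' f') : ExtensionDiagram t t'' (f ≫ f') where
  d := e.d ≫ e'.d
  h := e.h ≫ e'.h
  match_comp := by rw [← Category.assoc, e.match_comp, e'.match_comp]
  interface_comp := by rw [← Category.assoc, e.interface_comp, e'.interface_comp]
  comatch_comp := by rw [← Category.assoc, e.comatch_comp, e'.comatch_comp]
  left := e.left.paste_vert e'.left
  right := e.right.paste_vert e'.right

/-- The inverse of an extension diagram consisting of isomorphisms. -/
noncomputable def ExtensionDiagram.symm {p : PlainRule M} {G G' : C} {t : DPO p G}
    {t' : DPO p G'} {f : G ⟶ G'} (e : ExtensionDiagram t t' f) [IsIso f] [IsIso e.d]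
    [IsIso e.h] : ExtensionDiagram t' t (inv f) where
  d := inv e.d
  h := inv e.h
  match_comp := by rw [IsIso.comp_inv_eq, e.match_comp]
  interface_comp := by rw [IsIso.comp_inv_eq, e.interface_comp]
  comatch_comp := by rw [IsIso.comp_inv_eq, e.comatch_comp]
  left := IsPushout.of_vert_isIso ⟨by
    rw [IsIso.eq_inv_comp, ← Category.assoc, IsIso.comp_inv_eq, e.left.w]⟩
  right := IsPushout.of_vert_isIso ⟨by
    rw [IsIso.eq_inv_comp, ← Category.assoc, IsIso.comp_inv_eq, e.right.w]⟩

/-- The context morphism is determined because `t'.k` is mono, and the morphism of results because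
`t.H` is a pushout. Uniqueness of embeddings thus reduces to that of the extension morphism. -/
theorem ExtensionDiagram.subsingleton (hM : IsMAdhesive M) {p : PlainRule M} {G G' : C}
    (t : DPO p G) (t' : DPO p G') (f : G ⟶ G') : Subsingleton (ExtensionDiagram t t' f) := by
  refine ⟨fun e e' => ?_⟩
  have := hM.mono _ (t'.k_mem hM)
  have hd : e.d = e'.d := by rw [← cancel_mono t'.k, ← e.left.w, ← e'.left.w]
  have hh : e.h = e'.h := by
    apply t.right.hom_ext
    · rw [e.comatch_comp, e'.comatch_comp]
    · rw [e.right.w, e'.right.w, hd]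
  cases e
  cases e'
  cases hd
  cases hh
  rfl

variable {p₁ p₂ : PlainRule M} {tp tp' tp'' : PlainPair p₁ p₂}

/-- The identity embedding. -/
def Embedding.refl (tp : PlainPair p₁ p₂) : Embedding tp tp :=
  ⟨𝟙 _, .refl _, .refl _⟩

/-- The composition of embeddings. -/
def Embedding.trans (e : Embedding tp tp') (e' : Embedding tp' tp'') : Embedding tp tp'' :=
  ⟨e.f ≫ e'.f, e.e₁.trans e'.e₁, e.e₂.trans e'.e₂⟩

@[simp]
theorem Embedding.refl_f (tp : PlainPair p₁ p₂) : (Embedding.refl tp).f = 𝟙 _ := rfl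

@[simp]
theorem Embedding.trans_f (e : Embedding tp tp') (e' : Embedding tp' tp'') :
    (e.trans e').f = e.f ≫ e'.f := rfl

/-- An embedding is determined by its extension morphism. -/
theorem Embedding.ext_f (hM : IsMAdhesive M) {e e' : Embedding tp tp'} (h : e.f = e'.f) :
    e = e' := by
  obtain ⟨f, a, b⟩ := e
  obtain ⟨f', a', b'⟩ := e'
  cases h
  have := ExtensionDiagram.subsingleton hM tp.t₁ tp'.t₁ f
  have := ExtensionDiagram.subsingleton hM tp.t₂ tp'.t₂ f
  rw [Subsingleton.elim a a', Subsingleton.elim b b']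

theorem PlainPair.isomorphic_of_comp_eq_id (hM : IsMAdhesive M) (a : Embedding tp tp')
    (b : Embedding tp' tp) (hab : a.f ≫ b.f = 𝟙 _) (hba : b.f ≫ a.f = 𝟙 _) :
    tp.Isomorphic tp' := by
  have h₁ : a.trans b = .refl tp := Embedding.ext_f hM hab
  have h₂ : b.trans a = .refl tp' := Embedding.ext_f hM hba
  exact ⟨a, ⟨b.f, hab, hba⟩,
    ⟨b.e₁.d, congrArg (fun e => e.e₁.d) h₁, congrArg (fun e => e.e₁.d) h₂⟩,
    ⟨b.e₁.h, congrArg (fun e => e.e₁.h) h₁, congrArg (fun e => e.e₁.h) h₂⟩,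
    ⟨b.e₂.d, congrArg (fun e => e.e₂.d) h₁, congrArg (fun e => e.e₂.d) h₂⟩,
    ⟨b.e₂.h, congrArg (fun e => e.e₂.h) h₁, congrArg (fun e => e.e₂.h) h₂⟩⟩

theorem PlainPair.Isomorphic.exists_inverse (h : tp.Isomorphic tp') :
    ∃ (a : Embedding tp tp') (b : Embedding tp' tp), a.f ≫ b.f = 𝟙 _ ∧ b.f ≫ a.f = 𝟙 _ := by
  obtain ⟨a, _, _, _, _, _⟩ := h
  exact ⟨a, ⟨inv a.f, a.e₁.symm, a.e₂.symm⟩, by simp, by simp⟩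

theorem PlainPair.Isomorphic.refl (tp : PlainPair p₁ p₂) : tp.Isomorphic tp :=
  ⟨.refl tp, inferInstanceAs (IsIso (𝟙 _)), inferInstanceAs (IsIso (𝟙 _)),
    inferInstanceAs (IsIso (𝟙 _)), inferInstanceAs (IsIso (𝟙 _)), inferInstanceAs (IsIso (𝟙 _))⟩

theorem PlainPair.Isomorphic.symm (hM : IsMAdhesive M) (h : tp.Isomorphic tp') :
    tp'.Isomorphic tp := by
  obtain ⟨a, b, hab, hba⟩ := h.exists_inverse
  exact isomorphic_of_comp_eq_id hM b a hba hab

theorem PlainPair.Isomorphic.trans (hM : IsMAdhesive M) (h : tp.Isomorphic tp')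
    (h' : tp'.Isomorphic tp'') : tp.Isomorphic tp'' := by
  obtain ⟨a, b, hab, hba⟩ := h.exists_inverse
  obtain ⟨a', b', hab', hba'⟩ := h'.exists_inverse
  refine isomorphic_of_comp_eq_id hM (a.trans a') (b'.trans b) ?_ ?_
  · simp [reassoc_of% hab', hab]
  · simp [reassoc_of% hba, hba']

/-- Embeddings preserve and reflect parallel independence of plain pairs. -/
theorem Embedding.parallelIndependent_iff (hM : IsMAdhesive M) (e : Embedding tp tp') :
    tp.ParallelIndependent ↔ tp'.ParallelIndependent := by
  constructor
  · rintro ⟨⟨d, hd⟩, ⟨d', hd'⟩⟩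
    refine ⟨⟨d ≫ e.e₂.d, ?_⟩, ⟨d' ≫ e.e₁.d, ?_⟩⟩
    · rw [Category.assoc, ← e.e₂.left.w, reassoc_of% hd, e.e₁.match_comp]
    · rw [Category.assoc, ← e.e₁.left.w, reassoc_of% hd', e.e₂.match_comp]
  · rintro ⟨⟨d, hd⟩, ⟨d', hd'⟩⟩
    -- Pushouts along `k ∈ M` are pullbacks, so a morphism into the larger context lifts to the
    -- smaller one.
    have pb₁ := hM.isPullback_of_isPushout (tp.t₁.k_mem hM) e.e₁.left
    have pb₂ := hM.isPullback_of_isPushout (tp.t₂.k_mem hM) e.e₂.left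
    exact ⟨⟨pb₂.lift d tp.t₁.m (by rw [hd, e.e₁.match_comp]), pb₂.lift_snd _ _ _⟩,
      ⟨pb₁.lift d' tp.t₂.m (by rw [hd', e.e₂.match_comp]), pb₁.lift_snd _ _ _⟩⟩

/-! ### Initial transformation pairs -/

/-- A pair is self-initial if every pair embedding into it admits a unique embedding from it that
splits the given embedding. -/
def PlainPair.IsSelfInitial (tp : PlainPair p₁ p₂) : Prop :=
  ∀ (tp' : PlainPair p₁ p₂) (e : Embedding tp' tp),
    ∃! e' : Embedding tp tp', e'.f ≫ e.f = 𝟙 _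

theorem PlainPair.IsSelfInitial.isInitialTransfPair (h : tp.IsSelfInitial) :
    IsInitialTransfPair tp tp :=
  ⟨.refl tp, h⟩

/-- A pair over `tp` also embeds into `tp'`, so initiality yields a candidate; it is a splitting
already over `tp` by uniqueness of the embedding of `tp` into itself. -/
theorem IsInitialTransfPair.isSelfInitial (h : IsInitialTransfPair tp tp') :
    tp.IsSelfInitial := by
  obtain ⟨eI, hI⟩ := h
  intro s e
  obtain ⟨e', he', hu⟩ := hI s (e.trans eI)
  have huniq := (hI tp eI).unique (y₁ := e'.trans e) (y₂ := .refl tp)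
    (by simpa using he') (by simp)
  refine ⟨e', congrArg Embedding.f huniq, fun e'' he'' => hu e'' ?_⟩
  simp [reassoc_of% he'']

theorem PlainPair.IsSelfInitial.of_isomorphic (h : tp'.IsSelfInitial) (hi : tp.Isomorphic tp')
    (hM : IsMAdhesive M) : tp.IsSelfInitial := by
  obtain ⟨a, b, hab, hba⟩ := hi.exists_inverse
  intro s e
  obtain ⟨e', he', hu⟩ := h s (e.trans a)
  simp only [Embedding.trans_f] at he' hu
  refine ⟨a.trans e', ?_, fun e'' he'' => ?_⟩
  -- `e'` splits `e` followed by the isomorphism `a`, so cancelling `a` leaves its inverse.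
  · have : e'.f ≫ e.f = b.f := by
      rw [← Category.comp_id (e'.f ≫ e.f), ← hab, Category.assoc, reassoc_of% he']
    simp [this, hab]
  · have h₁ : b.trans e'' = e' := hu _ (by simp [reassoc_of% he'', hba])
    refine Embedding.ext_f hM ?_
    rw [← h₁]
    simp [reassoc_of% hab]

theorem PlainPair.IsPlainInitialConflict.isSelfInitial (hM : IsMAdhesive M)
    (h : tp.IsPlainInitialConflict) : tp.IsSelfInitial := by
  obtain ⟨-, tpI, hI, hi⟩ := h
  have hs := hI.isSelfInitial
  exact hs.of_isomorphic hi hM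

/-- A self-initial pair is isomorphic to the initial pair of every pair it embeds into. -/
theorem PlainPair.IsSelfInitial.isomorphic_of_embedding (hM : IsMAdhesive M)
    (h : tp.IsSelfInitial) (e : Embedding tp tp') (hI : IsInitialTransfPair tp'' tp') :
    tp.Isomorphic tp'' := by
  obtain ⟨eI, hI⟩ := hI
  obtain ⟨a, ha, -⟩ := hI tp e
  -- Self-initiality splits `a` on one side; uniqueness for the initial pair `tp''` makes the other
  -- composite the identity.
  obtain ⟨b, hb, -⟩ := h tp'' a
  have huniq := (hI tp'' eI).unique (y₁ := a.trans b) (y₂ := .refl tp'')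
    (by simp [← ha, reassoc_of% hb]) (by simp)
  exact isomorphic_of_comp_eq_id hM b a hb (congrArg Embedding.f huniq)

/-- A compatible morphism between the context objects extends to an extension diagram. -/
theorem DPO.exists_extensionDiagram {p : PlainRule M} {G G' : C} (t : DPO p G) (t' : DPO p G')
    (f : G ⟶ G') (d : t.D ⟶ t'.D) (hm : t.m ≫ f = t'.m) (hi : t.i ≫ d = t'.i)
    (hk : t.k ≫ f = d ≫ t'.k) : Nonempty (ExtensionDiagram t t' f) := by
  obtain ⟨q, hq, po⟩ := exists_split_of_isPushout hi t.left t'.left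
  obtain ⟨h, hn, po'⟩ := exists_split_of_isPushout hi t.right t'.right
  have : q = f := t.left.hom_ext (hq.trans hm.symm) (po.w.trans hk.symm)
  exact ⟨⟨d, h, hm, hi, hn, this ▸ po, po'⟩⟩

/-- Every parallel independent pair is an extension of the pair on the coproduct. -/
theorem PlainPair.ParallelIndependent.exists_embedding [HasBinaryCoproducts C]
    (h : tp.ParallelIndependent) : Nonempty (Embedding (coprodPair p₁ p₂) tp) := by
  obtain ⟨⟨d, hd⟩, ⟨d', hd'⟩⟩ := h
  -- Independence is what maps the summand `L₂` of the context `I₁ + L₂` into `D₁`.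
  obtain ⟨e₁⟩ := (coprodPair p₁ p₂).t₁.exists_extensionDiagram tp.t₁
    (coprod.desc tp.t₁.m tp.t₂.m) (coprod.desc tp.t₁.i d') (coprod.inl_desc _ _)
    (coprod.inl_desc _ _) (by
      refine Limits.coprod.hom_ext ?_ ?_ <;> simp [coprodPair, tp.t₁.left.w, hd'])
  obtain ⟨e₂⟩ := (coprodPair p₁ p₂).t₂.exists_extensionDiagram tp.t₂
    (coprod.desc tp.t₁.m tp.t₂.m) (coprod.desc d tp.t₂.i) (coprod.inr_desc _ _)
    (coprod.inr_desc _ _) (by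
      refine Limits.coprod.hom_ext ?_ ?_ <;> simp [coprodPair, tp.t₂.left.w, hd])
  exact ⟨⟨_, e₁, e₂⟩⟩

theorem coprodPair_parallelIndependent [HasBinaryCoproducts C] :
    (coprodPair p₁ p₂).ParallelIndependent :=
  ⟨⟨(coprod.inl : p₁.L ⟶ p₁.L ⨿ p₂.I), by simp [coprodPair]⟩,
    ⟨(coprod.inr : p₂.L ⟶ p₁.I ⨿ p₂.L), by simp [coprodPair]⟩⟩

end Embeddings

/-! ### Symbolic transformation pairs -/

section Symbolic

variable {C : Type u} [Category.{v} C] {M : MorphismProperty C} {E' : PairClass C}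
  {ρ₁ ρ₂ : Rule M}

/-- The independence morphism of `tp'` is that of `tp` followed by the context morphism of the
embedding. `AC.sat_left` moves the condition across the extension diagram and `AC.sat_shift` removes
the shift. -/
theorem exists_of_sat_independenceAC₁₂ (hM : IsMAdhesive M)
    (hE' : HasUniquePairFactorization E' M) {tp tp' : PlainPair ρ₁.toPlainRule ρ₂.toPlainRule}
    (e : Embedding tp tp') (h : (independenceAC₁₂ E' tp).Sat M e.f) :
    ∃ d : ρ₁.L ⟶ tp'.t₂.D, d ≫ tp'.t₂.k = tp'.t₁.m ∧ ρ₁.ac.Sat M (d ≫ tp'.t₂.c) := by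
  unfold independenceAC₁₂ at h
  split_ifs at h with hd
  · have hk := hd.choose_spec
    generalize hd.choose = d at h hk
    rw [AC.sat_left hM _ (tp.t₂.k_mem hM) (tp.t₂.c_mem hM) e.e₂.left e.e₂.right,
      AC.sat_shift hM hE', Category.assoc, e.e₂.right.w] at h
    refine ⟨d ≫ e.e₂.d, ?_, by rwa [Category.assoc]⟩
    rw [Category.assoc, ← e.e₂.left.w, reassoc_of% hk, e.e₁.match_comp]
  · exact absurd h (AC.not_sat_ff _)

theorem exists_of_sat_independenceAC₂₁ (hM : IsMAdhesive M)
    (hE' : HasUniquePairFactorization E' M) {tp tp' : PlainPair ρ₁.toPlainRule ρ₂.toPlainRule}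
    (e : Embedding tp tp') (h : (independenceAC₂₁ E' tp).Sat M e.f) :
    ∃ d : ρ₂.L ⟶ tp'.t₁.D, d ≫ tp'.t₁.k = tp'.t₂.m ∧ ρ₂.ac.Sat M (d ≫ tp'.t₁.c) := by
  unfold independenceAC₂₁ at h
  split_ifs at h with hd
  · have hk := hd.choose_spec
    generalize hd.choose = d at h hk
    rw [AC.sat_left hM _ (tp.t₁.k_mem hM) (tp.t₁.c_mem hM) e.e₁.left e.e₁.right,
      AC.sat_shift hM hE', Category.assoc, e.e₁.right.w] at h
    refine ⟨d ≫ e.e₁.d, ?_, by rwa [Category.assoc]⟩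
    rw [Category.assoc, ← e.e₁.left.w, reassoc_of% hk, e.e₂.match_comp]
  · exact absurd h (AC.not_sat_ff _)

/-- The extension morphism of every embedding into a conflict satisfies both conditions of the
symbolic transformation pair. -/
theorem SymbolicPair.sat_of_embedding (hM : IsMAdhesive M)
    (hE' : HasUniquePairFactorization E' M) (s : SymbolicPair E' ρ₁ ρ₂) (tp : TransfPair ρ₁ ρ₂)
    (htp : tp.Conflicting) (e : Embedding s.tp tp.toPlainPair) :
    (AC.and s.extAC s.conflictAC).Sat M e.f := by
  rw [AC.sat_and, s.extAC_eq, s.conflictAC_eq, extensionAC, AC.sat_and, AC.sat_shift hM hE',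
    AC.sat_shift hM hE', e.e₁.match_comp, e.e₂.match_comp]
  refine ⟨⟨tp.sat₁, tp.sat₂⟩, fun h => htp ?_⟩
  rw [AC.sat_and] at h
  exact ⟨exists_of_sat_independenceAC₁₂ hM hE' e h.1, exists_of_sat_independenceAC₂₁ hM hE' e h.2⟩

/-- The symbolic transformation pair with a given pair of AC-disregarding transformations. -/
noncomputable def SymbolicPair.ofPlainPair (E' : PairClass C)
    (tp : PlainPair ρ₁.toPlainRule ρ₂.toPlainRule) : SymbolicPair E' ρ₁ ρ₂ :=
  ⟨tp, _, _, rfl, rfl⟩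

/-- Some initial conflict embeds into every conflict. -/
theorem exists_initialConflict_embedding [HasBinaryCoproducts C] (hM : IsMAdhesive M)
    (hI : ∀ tp : PlainPair ρ₁.toPlainRule ρ₂.toPlainRule, tp.Conflicting →
      ∃ tpI : PlainPair ρ₁.toPlainRule ρ₂.toPlainRule, IsInitialTransfPair tpI tp)
    (tp : TransfPair ρ₁ ρ₂) (htp : tp.Conflicting) :
    ∃ s : SymbolicPair E' ρ₁ ρ₂, s.IsInitialConflict ∧
      Nonempty (Embedding s.tp tp.toPlainPair) := by
  -- A conflict may be independent as a plain pair, the conditions alone causing the dependence.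
  by_cases h : tp.toPlainPair.ParallelIndependent
  · obtain ⟨e⟩ := h.exists_embedding
    exact ⟨.ofPlainPair E' (coprodPair _ _), ⟨⟨tp, ⟨e⟩, htp⟩,
      .inr ⟨coprodPair_parallelIndependent, .refl _⟩⟩, ⟨e⟩⟩
  · obtain ⟨tpI, hI⟩ := hI _ h
    obtain ⟨e, -⟩ := id hI
    have hs := hI.isSelfInitial
    exact ⟨.ofPlainPair E' tpI, ⟨⟨tp, ⟨e⟩, htp⟩,
      .inl ⟨mt (e.parallelIndependent_iff hM).1 h, tpI, hs.isInitialTransfPair, .refl _⟩⟩, ⟨e⟩⟩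

theorem SymbolicPair.IsInitialConflict.isPlainInitialConflict [HasBinaryCoproducts C]
    {s : SymbolicPair E' ρ₁ ρ₂} (h : s.IsInitialConflict) (hc : s.tp.Conflicting) :
    s.tp.IsPlainInitialConflict :=
  h.2.resolve_right fun h' => hc h'.1

theorem SymbolicPair.IsInitialConflict.isomorphic_coprodPair [HasBinaryCoproducts C]
    {s : SymbolicPair E' ρ₁ ρ₂} (h : s.IsInitialConflict) (hc : s.tp.ParallelIndependent) :
    s.tp.Isomorphic (coprodPair ρ₁.toPlainRule ρ₂.toPlainRule) :=
  (h.2.resolve_left fun h' => h'.1 hc).2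

/-- If a self-initial conflict and another pair embed into the same pair, then the conflict is
isomorphic to the initial pair of the other one. -/
theorem PlainPair.IsSelfInitial.isomorphic_of_cospan (hM : IsMAdhesive M)
    {p₁ p₂ : PlainRule M} {s s' tp tpI J : PlainPair p₁ p₂} (hs : s.IsSelfInitial)
    (e : Embedding s tp) (e' : Embedding s' tp) (hI : IsInitialTransfPair tpI tp)
    (hJ : IsInitialTransfPair J s') : s.Isomorphic J := by
  -- `s` is the initial pair of `tp`, and initiality embeds that pair into `s'`; hence `s` embeds
  -- into `s'`.
  obtain ⟨a, -⟩ := (hs.isomorphic_of_embedding hM e hI).exists_inverse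
  obtain ⟨eI, hu⟩ := hI
  obtain ⟨b, -⟩ := hu s' e'
  exact hs.isomorphic_of_embedding hM (a.trans b) hJ

/-- Initial conflicts are isomorphic if some pair embeds into conflicts that extend them. -/
theorem SymbolicPair.IsInitialConflict.isomorphic [HasBinaryCoproducts C] (hM : IsMAdhesive M)
    (hI : ∀ tp : PlainPair ρ₁.toPlainRule ρ₂.toPlainRule, tp.Conflicting →
      ∃ tpI : PlainPair ρ₁.toPlainRule ρ₂.toPlainRule, IsInitialTransfPair tpI tp)
    {s t : SymbolicPair E' ρ₁ ρ₂} (hs : s.IsInitialConflict) (ht : t.IsInitialConflict)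
    {s' tps tpt : PlainPair ρ₁.toPlainRule ρ₂.toPlainRule} (es : Embedding s.tp tps)
    (et : Embedding t.tp tpt) (es' : Embedding s' tps) (et' : Embedding s' tpt) :
    s.Isomorphic t := by
  have hps := (es.parallelIndependent_iff hM).trans (es'.parallelIndependent_iff hM).symm
  have hpt := (et.parallelIndependent_iff hM).trans (et'.parallelIndependent_iff hM).symm
  -- All the pairs involved are plainly independent or none is, since embeddings connect them.
  by_cases h : s'.ParallelIndependent
  · exact (hs.isomorphic_coprodPair (hps.2 h)).trans hM
      ((ht.isomorphic_coprodPair (hpt.2 h)).symm hM)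
  · obtain ⟨J, hJ⟩ := hI s' h
    obtain ⟨Is, hIs⟩ := hI tps (mt (es'.parallelIndependent_iff hM).2 h)
    obtain ⟨It, hIt⟩ := hI tpt (mt (et'.parallelIndependent_iff hM).2 h)
    have hs' := (hs.isPlainInitialConflict (mt hps.1 h)).isSelfInitial hM
    have ht' := (ht.isPlainInitialConflict (mt hpt.1 h)).isSelfInitial hM
    exact (hs'.isomorphic_of_cospan hM es es' hIs hJ).trans hM
      ((ht'.isomorphic_of_cospan hM et et' hIt hJ).symm hM)

end Symbolic

end MTransf

theorem mainTheorem2 {C : Type u} [Category.{v} C] [HasBinaryCoproducts C]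
    (M : MorphismProperty C) (hM : MTransf.IsMAdhesive M)
    (E' : MTransf.PairClass C) (hE' : MTransf.HasUniquePairFactorization E' M)
    (R : Set (MTransf.Rule M)) (hR : MTransf.HasInitialTransfPairsForConflicts R)
    (ρ₁ ρ₂ : MTransf.Rule M) (hρ₁ : ρ₁ ∈ R) (hρ₂ : ρ₂ ∈ R)
    (S : Set (MTransf.SymbolicPair E' ρ₁ ρ₂))
    (hS : MTransf.IsSetOfInitialConflictsUpToIso S) :
    MTransf.IsMinimallyComplete S := by
  have hI := hR ρ₁ hρ₁ ρ₂ hρ₂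
  refine ⟨fun tp htp => ?_, ?_⟩
  · obtain ⟨s, hs, ⟨e⟩⟩ := MTransf.exists_initialConflict_embedding (E' := E') hM hI tp htp
    obtain ⟨s', ⟨hs', hi⟩, -⟩ := hS.2 s hs
    obtain ⟨-, b, -⟩ := hi.exists_inverse
    exact ⟨s', hs', b.trans e, s'.sat_of_embedding hM hE' tp htp _⟩
  · rintro ⟨S', hS', hlt⟩
    refine hlt.not_ge ?_
    -- Being conflict-inducing provides a conflict above `s`, and completeness of `S'` provides an
    -- element embedding into it.
    have key : ∀ s : S, ∃ s' : S', ∃ tp : MTransf.TransfPair ρ₁ ρ₂,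
        Nonempty (MTransf.Embedding s.1.tp tp.toPlainPair) ∧
        Nonempty (MTransf.Embedding s'.1.tp tp.toPlainPair) := fun s => by
      obtain ⟨tp, he, htp⟩ := (hS.1 s.1 s.2).1
      obtain ⟨s', hs', e', -⟩ := hS' tp htp
      exact ⟨⟨s', hs'⟩, tp, he, ⟨e'⟩⟩
    choose g tp he he' using key
    refine Cardinal.mk_le_of_injective (f := g) fun s t hst => ?_
    obtain ⟨es⟩ := he s
    obtain ⟨et⟩ := he t
    obtain ⟨es'⟩ := he' s
    obtain ⟨et'⟩ := he' t
    rw [hst] at es'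
    have hi := (hS.1 s.1 s.2).isomorphic hM hI (hS.1 t.1 t.2) es et es' et'
    -- Both `s` and `t` represent the isomorphism class of `s` in `S`, so they coincide.
    exact Subtype.ext ((hS.2 s.1 (hS.1 s.1 s.2)).unique
      ⟨s.2, MTransf.PlainPair.Isomorphic.refl _⟩ ⟨t.2, hi⟩)
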